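/- Let $\mathfrak{C}$ be the real division algebra of octonions (Cayley numbers) and let $\mathfrak{J}=\{X\in M(3,\mathfrak{C}) \mid X^*=X\}$ be the exceptional Jordan algebra, with Jordan product $X\circ Y=\tfrac12(XY+YX)$, symmetric bilinear form $(X,Y)=\operatorname{tr}(X\circ Y)$ and Freudenthal product $$X\times Y=\tfrac12\bigl(2\,X\circ Y-\operatorname{tr}(X)Y-\operatorname{tr}(Y)X+(\operatorname{tr}(X)\operatorname{tr}(Y)-(X,Y))E\bigr),$$ where $E$ is the unit matrix. Let $\mathfrak{J}^{C}$ be the complexification of $\mathfrak{J}$, with these operations extended $\mathbb{C}$-bilinearly, let $\tau$ be the complex conjugation of $\mathfrak{J}^{C}$ with respect to $\mathfrak{J}$, and put $\langle X,Y\rangle=(\tau X,Y)$. Let $E_1=\operatorname{diag}(1,0,0)$ and $E_2=\operatorname{diag}(0,1,0)$. The simply connected compact Lie group $E_6$ is realized as $$E_6=\{\alpha\in\operatorname{Iso}_{\mathbb{C}}(\mathfrak{J}^{C}) \mid \alpha X\times\alpha Y=\tau\alpha\tau(X\times Y),\ \langle\alpha X,\alpha Y\rangle=\langle X,Y\rangle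 \text{ for all } X,Y\in\mathfrak{J}^{C}\},$$ and $Spin_k(10)=\{\alpha\in E_6\mid \alpha E_k=E_k\}$ for $k=1,2$. **Theorem 7.** Every element $\alpha\in E_6$ can be written as $\alpha=\alpha_1\alpha_2\alpha_1'$ with $\alpha_1,\alpha_1'\in Spin_1(10)$ and $\alpha_2\in Spin_2(10)$. -/

import Mathlib

open scoped Quaternion

namespace ExceptionalE6

/-- The Cayley algebra over a commutative ring `R`, obtained from the quaternions by doubling:
`⟨m, a⟩` stands for `m + a e₄` with `m, a` quaternions. For `R = ℝ` this is the division algebra of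
octonions `𝔠`, for `R = ℂ` it is the complexification `𝔠 ⊗ ℂ`. -/
@[ext]
structure Cayley (R : Type*) [CommRing R] where
  fst : ℍ[R]
  snd : ℍ[R]

namespace Cayley

variable {R : Type*} [CommRing R]

instance : Zero (Cayley R) := ⟨⟨0, 0⟩⟩
instance : One (Cayley R) := ⟨⟨1, 0⟩⟩
instance : Add (Cayley R) := ⟨fun x y => ⟨x.fst + y.fst, x.snd + y.snd⟩⟩
instance : Neg (Cayley R) := ⟨fun x => ⟨-x.fst, -x.snd⟩⟩
instance : Sub (Cayley R) := ⟨fun x y => ⟨x.fst - y.fst, x.snd - y.snd⟩⟩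
instance {S : Type*} [SMul S R] : SMul S (Cayley R) := ⟨fun s x => ⟨s • x.fst, s • x.snd⟩⟩

/-- `(m + a e₄)(n + b e₄) = (m n - b̄ a) + (a n̄ + b m) e₄`. -/
instance : Mul (Cayley R) :=
  ⟨fun x y => ⟨x.fst * y.fst - star y.snd * x.snd, x.snd * star y.fst + y.snd * x.fst⟩⟩

/-- The conjugation `m + a e₄ ↦ m̄ - a e₄`; it is `R`-linear (also for `R = ℂ`). -/
instance : Star (Cayley R) := ⟨fun x => ⟨star x.fst, -x.snd⟩⟩

@[simp] theorem fst_zero : (0 : Cayley R).fst = 0 := rfl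
@[simp] theorem snd_zero : (0 : Cayley R).snd = 0 := rfl
@[simp] theorem fst_one : (1 : Cayley R).fst = 1 := rfl
@[simp] theorem snd_one : (1 : Cayley R).snd = 0 := rfl
@[simp] theorem fst_add (x y : Cayley R) : (x + y).fst = x.fst + y.fst := rfl
@[simp] theorem snd_add (x y : Cayley R) : (x + y).snd = x.snd + y.snd := rfl
@[simp] theorem fst_neg (x : Cayley R) : (-x).fst = -x.fst := rfl
@[simp] theorem snd_neg (x : Cayley R) : (-x).snd = -x.snd := rfl
@[simp] theorem fst_sub (x y : Cayley R) : (x - y).fst = x.fst - y.fst := rfl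
@[simp] theorem snd_sub (x y : Cayley R) : (x - y).snd = x.snd - y.snd := rfl
@[simp] theorem fst_smul {S : Type*} [SMul S R] (s : S) (x : Cayley R) :
    (s • x).fst = s • x.fst := rfl
@[simp] theorem snd_smul {S : Type*} [SMul S R] (s : S) (x : Cayley R) :
    (s • x).snd = s • x.snd := rfl
@[simp] theorem fst_mul (x y : Cayley R) :
    (x * y).fst = x.fst * y.fst - star y.snd * x.snd := rfl
@[simp] theorem snd_mul (x y : Cayley R) :
    (x * y).snd = x.snd * star y.fst + y.snd * x.fst := rfl
@[simp] theorem fst_star (x : Cayley R) : (star x).fst = star x.fst := rfl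
@[simp] theorem snd_star (x : Cayley R) : (star x).snd = -x.snd := rfl

/-- The underlying pair of quaternions. -/
def toProd (x : Cayley R) : ℍ[R] × ℍ[R] := (x.fst, x.snd)

theorem toProd_injective : Function.Injective (toProd : Cayley R → ℍ[R] × ℍ[R]) := by
  intro x y h
  exact Cayley.ext (congrArg Prod.fst h) (congrArg Prod.snd h)

instance : AddCommGroup (Cayley R) :=
  toProd_injective.addCommGroup toProd rfl (fun _ _ => rfl) (fun _ => rfl) (fun _ _ => rfl)
    (fun _ _ => rfl) (fun _ _ => rfl)

/-- `toProd` as an additive homomorphism. -/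
def toProdHom : Cayley R →+ ℍ[R] × ℍ[R] where
  toFun := toProd
  map_zero' := rfl
  map_add' _ _ := rfl

instance : Module R (Cayley R) :=
  toProd_injective.module R toProdHom (fun _ _ => rfl)

instance : NonUnitalNonAssocRing (Cayley R) where
  left_distrib x y z := by ext1 <;> simp <;> noncomm_ring
  right_distrib x y z := by ext1 <;> simp <;> noncomm_ring
  zero_mul x := by ext1 <;> simp
  mul_zero x := by ext1 <;> simp

instance : StarRing (Cayley R) where
  star_involutive x := by ext1 <;> simp
  star_mul x y := by ext1 <;> simp
  star_add x y := by ext1 <;> simp [add_comm]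

theorem star_smul' (r : R) (x : Cayley R) : star (r • x) = r • star x := by
  ext1 <;> simp

theorem star_one' : star (1 : Cayley R) = 1 := by
  ext1 <;> simp

/-- The scalar part of `x`: its coefficient at the unit `1`. -/
def re (x : Cayley R) : R := x.fst.re

/-- Complex conjugation of the four coordinates of a complexified quaternion. -/
def quatConj (q : ℍ[ℂ]) : ℍ[ℂ] :=
  ⟨starRingEnd ℂ q.re, starRingEnd ℂ q.imI, starRingEnd ℂ q.imJ, starRingEnd ℂ q.imK⟩

@[simp] theorem re_quatConj (q : ℍ[ℂ]) : (quatConj q).re = starRingEnd ℂ q.re := rfl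
@[simp] theorem imI_quatConj (q : ℍ[ℂ]) : (quatConj q).imI = starRingEnd ℂ q.imI := rfl
@[simp] theorem imJ_quatConj (q : ℍ[ℂ]) : (quatConj q).imJ = starRingEnd ℂ q.imJ := rfl
@[simp] theorem imK_quatConj (q : ℍ[ℂ]) : (quatConj q).imK = starRingEnd ℂ q.imK := rfl

/-- The complex conjugation `τ` of `𝔠 ⊗ ℂ` with respect to `𝔠`: `τ (p + i q) = p - i q` for
`p, q ∈ 𝔠`, that is, complex conjugation of all eight coordinates. -/
def conj (x : Cayley ℂ) : Cayley ℂ := ⟨quatConj x.fst, quatConj x.snd⟩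

theorem conj_conj (x : Cayley ℂ) : conj (conj x) = x := by
  ext <;> simp [conj]

theorem conj_star (x : Cayley ℂ) : conj (star x) = star (conj x) := by
  ext <;> simp [conj]

end Cayley

/-- The Hermitian `3 × 3` matrices `X* = X` over the Cayley algebra, where `X*` is the conjugate
transpose. For `R = ℝ` this is the exceptional Jordan algebra `𝔍`; for `R = ℂ` (the conjugation of
the Cayley algebra being extended `ℂ`-linearly) it is the complexification `𝔍^ℂ`. -/
def J (R : Type*) [CommRing R] : Submodule R (Matrix (Fin 3) (Fin 3) (Cayley R)) where
  carrier := {X | X.conjTranspose = X}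
  add_mem' {X Y} hX hY := by
    simp only [Set.mem_ofPred_eq] at *
    rw [Matrix.conjTranspose_add, hX, hY]
  zero_mem' := by simp
  smul_mem' r X hX := by
    simp only [Set.mem_ofPred_eq] at *
    ext1 i j
    rw [Matrix.conjTranspose_apply, Matrix.smul_apply, Matrix.smul_apply, Cayley.star_smul',
      ← Matrix.conjTranspose_apply, hX]

namespace J

section Field

variable {R : Type*} [Field R]

/-- The unit matrix `E`. -/
def E : J R := ⟨1, by
  change Matrix.conjTranspose 1 = 1
  ext1 i j
  rw [Matrix.conjTranspose_apply, Matrix.one_apply, Matrix.one_apply]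
  by_cases h : i = j
  · simp [h, Cayley.star_one']
  · simp [h, Ne.symm h]⟩

/-- The diagonal idempotents: `idem 0`, `idem 1`, `idem 2` are `E₁`, `E₂`, `E₃`. -/
def idem (k : Fin 3) : J R := ⟨Matrix.single k k 1, by
  change Matrix.conjTranspose (Matrix.single k k 1) = Matrix.single k k 1
  rw [Matrix.conjTranspose_single, Cayley.star_one']⟩

/-- The Jordan product `X ∘ Y = (XY + YX) / 2`. -/
def jmul (X Y : J R) : J R :=
  (2⁻¹ : R) • ⟨X.1 * Y.1 + Y.1 * X.1, by
    have hX : X.1.conjTranspose = X.1 := X.2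
    have hY : Y.1.conjTranspose = Y.1 := Y.2
    change (X.1 * Y.1 + Y.1 * X.1).conjTranspose = X.1 * Y.1 + Y.1 * X.1
    rw [Matrix.conjTranspose_add, Matrix.conjTranspose_mul, Matrix.conjTranspose_mul, hX, hY,
      add_comm]⟩

/-- The trace; the diagonal entries of a Hermitian matrix are scalars. -/
def tr (X : J R) : R := ∑ k, (X.1 k k).re

/-- The symmetric bilinear form `(X, Y) = tr (X ∘ Y)`. -/
def bilin (X Y : J R) : R := tr (jmul X Y)

/-- The Freudenthal product
`X × Y = (2 X ∘ Y - tr(X) Y - tr(Y) X + (tr(X) tr(Y) - (X, Y)) E) / 2`. -/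
def cross (X Y : J R) : J R :=
  (2⁻¹ : R) • ((2 : R) • jmul X Y - tr X • Y - tr Y • X + (tr X * tr Y - bilin X Y) • E)

end Field

/-- The complex conjugation `τ` of `𝔍^ℂ` with respect to `𝔍`, applied entrywise. -/
def tau (X : J ℂ) : J ℂ := ⟨X.1.map Cayley.conj, by
  have hX : X.1.conjTranspose = X.1 := X.2
  change (X.1.map Cayley.conj).conjTranspose = X.1.map Cayley.conj
  ext1 i j
  rw [Matrix.conjTranspose_apply, Matrix.map_apply, Matrix.map_apply, ← Cayley.conj_star,
    ← Matrix.conjTranspose_apply, hX]⟩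

theorem tau_tau (X : J ℂ) : tau (tau X) = X := by
  apply Subtype.ext
  ext1 i j
  exact Cayley.conj_conj _

/-- The Hermitian form `⟨X, Y⟩ = (τ X, Y)` on `𝔍^ℂ`. -/
noncomputable def herm (X Y : J ℂ) : ℂ := bilin (tau X) Y

end J

open J

/-- The group `E₆` of all `ℂ`-linear isomorphisms `α` of `𝔍^ℂ` with
`αX × αY = τ α τ (X × Y)` and `⟨αX, αY⟩ = ⟨X, Y⟩`. -/
def E6 : Subgroup (J ℂ ≃ₗ[ℂ] J ℂ) where
  carrier := {α | (∀ X Y, cross (α X) (α Y) = tau (α (tau (cross X Y)))) ∧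
    ∀ X Y, herm (α X) (α Y) = herm X Y}
  mul_mem' {α β} hα hβ :=
    ⟨fun X Y => by simp only [LinearEquiv.mul_apply, hα.1, hβ.1, tau_tau],
      fun X Y => by simp only [LinearEquiv.mul_apply, hα.2, hβ.2]⟩
  one_mem' := ⟨fun X Y => by simp only [LinearEquiv.coe_one, id_eq, tau_tau], fun X Y => rfl⟩
  inv_mem' {α} hα := by
    have key : ∀ X, α (α⁻¹ X) = X := fun X => α.apply_symm_apply X
    have key' : ∀ X, α⁻¹ (α X) = X := fun X => α.symm_apply_apply X
    refine ⟨fun X Y => ?_, fun X Y => ?_⟩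
    · have h := hα.1 (α⁻¹ X) (α⁻¹ Y)
      rw [key, key] at h
      rw [h, tau_tau, key', tau_tau]
    · have h := hα.2 (α⁻¹ X) (α⁻¹ Y)
      rw [key, key] at h
      exact h.symm

/-- The stabilizer of a diagonal idempotent in `E₆`: `Spin10 0` is
`Spin₁(10) = {α ∈ E₆ | α E₁ = E₁}` and `Spin10 1` is `Spin₂(10) = {α ∈ E₆ | α E₂ = E₂}`. -/
def Spin10 (k : Fin 3) : Subgroup (J ℂ ≃ₗ[ℂ] J ℂ) where
  carrier := {α | α ∈ E6 ∧ α (idem k) = idem k}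
  mul_mem' {α β} hα hβ :=
    ⟨E6.mul_mem hα.1 hβ.1, by rw [LinearEquiv.mul_apply, hβ.2, hα.2]⟩
  one_mem' := ⟨E6.one_mem, rfl⟩
  inv_mem' {α} hα := ⟨E6.inv_mem hα.1, by
    have h := α.symm_apply_apply (idem k)
    rw [hα.2] at h
    exact h⟩

end ExceptionalE6

/-!
The group `E₆` permutes the unit vectors `A` of rank one, that is, those with `A × A = 0` and
`⟨A, A⟩ = 1`, and `E₁` is one of them. Since `Spin₁(10)` is the stabilizer of `E₁`, the
factorization `α = α₁ α₂ α₁'` amounts to `α E₁ ∈ Spin₁(10) Spin₂(10) E₁`, so it suffices that every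
rank-one unit vector `A` can be moved to `E₁` by an element of `Spin₁(10)` followed by one of
`Spin₂(10)` (`exists_eq_idem_zero`). Write `ξᵢ` for the diagonal coordinates of `A` and `xᵢ` for the
off-diagonal ones, indices running over `Fin 3`, so that the idempotents `E₁`, `E₂` of the theorem
are `idem 0`, `idem 1`.

Under `Spin₁(10)` the space `𝔍^ℂ` splits into the line of `E₁`, the ten-dimensional space of
`v = (ξ₁, ξ₂, x₀)` and the space of spinors `(x₁, x₂)`. The equation `A × A = 0` means
`ξᵢ₊₁ ξᵢ₊₂ = N(xᵢ)` and `xᵢ₊₁ xᵢ₊₂ = ξᵢ x̄ᵢ` for all `i`; in particular `v` is isotropic. Three kinds of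
elements of `Spin₁(10)` suffice: rotations in the plane of the last two coordinates
(`exists_rotation`), diagonal phases (`exists_phase`), and the elements
`(x₀, x₁, x₂) ↦ (ā x₀ ā, a x₁, x₂ a)` for a real unit Cayley number `a`, which lie in `E₆` by the
Moufang identities (`exists_triality`). Every real Cayley number is a real multiple of the square of
a unit one (`exists_unit_sq`), so the last kind turns the real or the imaginary part of `x₀` into a
scalar; alternating with rotations and a phase gives `ξ₁ = 0` and `x₀ = 0`
(`exists_dg_one_od_zero_eq_zero`).

Next `x₂` is removed (`exists_reduction`). If then `ξ₂ ≠ 0`, it vanishes already by `A × A = 0`.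
If `ξ₂ = 0` and `x₂ ≠ 0`, then `x₂` is null and `x₁ x₂ = 0`, which forces `x̄₁ = x₂ w` with `w` real
(`exists_real_mul_eq`); writing `w = r a²`, the triality element of `a` makes `x̄₁` a real multiple
of `x₂`, and a rotation removes `x₂`.

Now `A = (ξ₀, ξ₂, x₁)` lies in the ten-dimensional representation of `Spin₂(10)`, which that group
preserves (`mem_vector_of_mem`). The same reduction of isotropic vectors, transported by the cyclic
permutation of the coordinates (`exists_shift`), leaves only `ξ₀`, and a phase makes it `1`.
-/

namespace ExceptionalE6

namespace Cayley

/-! ### The Cayley algebra: norm form, alternativity and Moufang identities -/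

section Ring
variable {R : Type*} [CommRing R]

/-- The quadratic norm form `N(x) = x x̄`, as a scalar. -/
def normForm (x : Cayley R) : R := (x * star x).re

@[simp] theorem re_zero : re (0 : Cayley R) = 0 := rfl
@[simp] theorem re_one : re (1 : Cayley R) = 1 := rfl
@[simp] theorem re_add (x y : Cayley R) : re (x + y) = re x + re y := rfl
@[simp] theorem re_sub (x y : Cayley R) : re (x - y) = re x - re y := rfl
@[simp] theorem re_neg (x : Cayley R) : re (-x) = -re x := rfl
@[simp] theorem re_smul (r : R) (x : Cayley R) : re (r • x) = r * re x := rfl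
@[simp] theorem re_star (x : Cayley R) : re (star x) = re x := by simp [re]

theorem re_mul_comm (x y : Cayley R) : re (x * y) = re (y * x) := by
  simp [re]; ring

protected theorem smul_mul (r : R) (x y : Cayley R) : (r • x) * y = r • (x * y) := by
  ext1 <;> simp [smul_sub, smul_add]
protected theorem mul_smul (r : R) (x y : Cayley R) : x * (r • y) = r • (x * y) := by
  ext1 <;> simp [smul_sub, smul_add]
protected theorem one_mul (x : Cayley R) : 1 * x = x := by ext1 <;> simp
protected theorem mul_one (x : Cayley R) : x * 1 = x := by ext1 <;> simp

theorem star_mul_mul_cancel (a x : Cayley R) : star a * (a * x) = normForm a • x := by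
  ext <;> simp [normForm, re] <;> ring

theorem mul_star_self (a : Cayley R) : a * star a = normForm a • 1 := by
  ext <;> simp [normForm, re] <;> ring

theorem add_star_self (x : Cayley R) : x + star x = (2 * re x) • 1 := by
  ext <;> simp [re]; ring

theorem normForm_star (a : Cayley R) : normForm (star a) = normForm a := by
  simp [normForm, re]

theorem normForm_smul (r : R) (a : Cayley R) : normForm (r • a) = r ^ 2 * normForm a := by
  simp [normForm, re]; ring

theorem star_mul_self (a : Cayley R) : star a * a = normForm a • 1 := by
  simpa [normForm_star] using mul_star_self (star a)

theorem mul_star_mul_cancel (a x : Cayley R) : a * (star a * x) = normForm a • x := by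
  simpa [normForm_star] using star_mul_mul_cancel (star a) x

theorem mul_mul_star_cancel (a x : Cayley R) : (x * a) * star a = normForm a • x := by
  have h := congrArg star (mul_star_mul_cancel a (star x))
  simpa [star_smul'] using h

theorem mul_star_mul_self_cancel (a x : Cayley R) : (x * star a) * a = normForm a • x := by
  simpa [normForm_star] using mul_mul_star_cancel (star a) x

theorem star_eq (a : Cayley R) : star a = (2 * re a) • 1 - a := by
  rw [← add_star_self]; abel

/-- The right alternative law. -/
theorem mul_mul_self (x a : Cayley R) : (x * a) * a = x * (a * a) := by
  have h := mul_star_mul_self_cancel a x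
  have h' := star_mul_self a
  rw [star_eq, mul_sub, sub_mul, Cayley.mul_smul, Cayley.mul_one, Cayley.smul_mul] at h
  rw [star_eq, sub_mul, Cayley.smul_mul, Cayley.one_mul] at h'
  have e : a * a = (2 * re a) • a - normForm a • 1 := by rw [← h']; abel
  rw [e, mul_sub, Cayley.mul_smul, Cayley.mul_smul, Cayley.mul_one, ← h]; abel

set_option maxHeartbeats 1000000 in
/-- The left Moufang identity. -/
theorem moufang_left (a x y : Cayley R) : ((a * x) * a) * y = a * (x * (a * y)) := by
  ext <;> simp <;> ring

/-- The flexible law. -/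
theorem flexible (a x : Cayley R) : (a * x) * a = a * (x * a) := by
  simpa [Cayley.mul_one] using moufang_left a x 1

/-- The right Moufang identity. -/
theorem moufang_right (a x y : Cayley R) : y * ((a * x) * a) = ((y * a) * x) * a := by
  have h := congrArg star (moufang_left (star a) (star x) (star y))
  simpa [← flexible] using h

variable {a : Cayley R}

/-- A form of the left Moufang identity, for `a` of norm one. -/
theorem triality_left (ha : normForm a = 1) (x y : Cayley R) :
    ((star a * x) * star a) * (a * y) = star a * (x * y) := by
  rw [moufang_left, star_mul_mul_cancel, ha, one_smul]

/-- A form of the right Moufang identity, for `a` of norm one. -/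
theorem triality_right (ha : normForm a = 1) (x y : Cayley R) :
    (x * a) * ((star a * y) * star a) = (x * y) * star a := by
  rw [moufang_right, mul_mul_star_cancel, ha, one_smul]

/-- The middle Moufang identity for `a` of norm one. -/
theorem triality_mid (ha : normForm a = 1) (x y : Cayley R) :
    (a * x) * (y * a) = (a * (x * y)) * a := by
  have hs : normForm (star a) = 1 := by rw [normForm_star, ha]
  have h1 := triality_left hs x y
  have h2 := triality_right hs ((a * x) * a) (star a * y)
  simp only [star_star, mul_mul_star_cancel, mul_star_mul_cancel, ha, one_smul] at h1 h2
  rw [h2, h1]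

end Ring

/-! ### Real Cayley numbers inside the complexified Cayley algebra -/

theorem conj_add (x y : Cayley ℂ) : conj (x + y) = conj x + conj y := by
  ext <;> simp [conj]
theorem conj_sub (x y : Cayley ℂ) : conj (x - y) = conj x - conj y := by
  ext <;> simp [conj]
theorem conj_zero : conj 0 = 0 := by
  ext <;> simp [conj]
theorem conj_one : conj 1 = 1 := by
  ext <;> simp [conj]
theorem conj_smul (c : ℂ) (x : Cayley ℂ) : conj (c • x) = starRingEnd ℂ c • conj x := by
  ext <;> simp [conj]
theorem conj_mul (x y : Cayley ℂ) : conj (x * y) = conj x * conj y := by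
  ext <;> simp [conj]
theorem re_conj (x : Cayley ℂ) : re (conj x) = starRingEnd ℂ (re x) := rfl

/-- The norm form of a real Cayley number is the square of a nonnegative real, its length. -/
theorem exists_length {p : Cayley ℂ} (hp : conj p = p) :
    ∃ n : ℝ, 0 ≤ n ∧ normForm p = (n : ℂ) ^ 2 ∧ (n = 0 → p = 0) := by
  have h : ∀ z : ℂ, starRingEnd ℂ z = z → z = (z.re : ℂ) := fun z hz =>
    (Complex.conj_eq_iff_re.1 hz).symm
  simp only [Cayley.ext_iff, Quaternion.ext_iff, conj, re_quatConj, imI_quatConj, imJ_quatConj,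
    imK_quatConj] at hp
  obtain ⟨⟨h0, h1, h2, h3⟩, h4, h5, h6, h7⟩ := hp
  replace h0 := h _ h0
  replace h1 := h _ h1
  replace h2 := h _ h2
  replace h3 := h _ h3
  replace h4 := h _ h4
  replace h5 := h _ h5
  replace h6 := h _ h6
  replace h7 := h _ h7
  refine ⟨√(p.fst.re.re ^ 2 + p.fst.imI.re ^ 2 + p.fst.imJ.re ^ 2 + p.fst.imK.re ^ 2 +
    p.snd.re.re ^ 2 + p.snd.imI.re ^ 2 + p.snd.imJ.re ^ 2 + p.snd.imK.re ^ 2),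
    Real.sqrt_nonneg _, ?_, fun hn => ?_⟩
  · rw [← Complex.ofReal_pow, Real.sq_sqrt (by positivity)]
    push_cast
    rw [← h0, ← h1, ← h2, ← h3, ← h4, ← h5, ← h6, ← h7]
    simp [normForm, re]
    ring
  · rw [Real.sqrt_eq_zero (by positivity)] at hn
    have e : ∀ i, ![p.fst.re.re, p.fst.imI.re, p.fst.imJ.re, p.fst.imK.re,
        p.snd.re.re, p.snd.imI.re, p.snd.imJ.re, p.snd.imK.re] i = 0 := by
      intro i
      apply pow_eq_zero_iff (two_ne_zero) |>.1
      fin_cases i <;> simp <;> nlinarith [sq_nonneg p.fst.re.re, sq_nonneg p.fst.imI.re,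
        sq_nonneg p.fst.imJ.re, sq_nonneg p.fst.imK.re, sq_nonneg p.snd.re.re,
        sq_nonneg p.snd.imI.re, sq_nonneg p.snd.imJ.re, sq_nonneg p.snd.imK.re]
    have e0 := e 0
    have e1 := e 1
    have e2 := e 2
    have e3 := e 3
    have e4 := e 4
    have e5 := e 5
    have e6 := e 6
    have e7 := e 7
    simp only [Matrix.cons_val] at e0 e1 e2 e3 e4 e5 e6 e7
    rw [e0] at h0; rw [e1] at h1; rw [e2] at h2; rw [e3] at h3
    rw [e4] at h4; rw [e5] at h5; rw [e6] at h6; rw [e7] at h7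
    ext <;> simp [h0, h1, h2, h3, h4, h5, h6, h7]

/-- Every real Cayley number is a real multiple of the square of a real unit Cayley number. -/
theorem exists_unit_sq {p : Cayley ℂ} (hp : conj p = p) :
    ∃ a : Cayley ℂ, conj a = a ∧ normForm a = 1 ∧ ∃ r : ℝ, p = (r : ℂ) • (a * a) := by
  obtain ⟨n, -, hN, -⟩ := exists_length hp
  -- the square root bisects the angle between `1` and `p`
  set b : Cayley ℂ := (n : ℂ) • 1 + p with hb
  have hbc : conj b = b := by rw [hb, conj_add, conj_smul, conj_one, hp, Complex.conj_ofReal]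
  obtain ⟨m, -, hM, hm0⟩ := exists_length hbc
  by_cases hm : m = 0
  · have h0 : p = -((n : ℂ) • 1) := (neg_eq_of_add_eq_zero_right (hm0 hm)).symm
    exact ⟨1, conj_one, by simp [normForm, star_one', Cayley.one_mul], -n, by
      rw [h0, Cayley.one_mul]; simp⟩
  have hm' : (m : ℂ) ≠ 0 := by exact_mod_cast hm
  have hsq : p * p = (2 * re p) • p - normForm p • 1 := by
    rw [← star_mul_self, star_eq, sub_mul, Cayley.smul_mul, Cayley.one_mul]; abel
  have hNb : normForm b = 2 * n * (n + re p) := by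
    have h1 : normForm b • (1 : Cayley ℂ) = (2 * n * (n + re p)) • (1 : Cayley ℂ) := by
      rw [← mul_star_self, hb, star_add, star_smul', star_one', star_eq p]
      simp only [mul_add, add_mul, mul_sub, Cayley.smul_mul, Cayley.mul_smul, Cayley.mul_one,
        Cayley.one_mul,
        hsq, hN]
      module
    have h2 := congrArg re h1
    simpa using h2
  refine ⟨(m : ℂ)⁻¹ • b, ?_, ?_, n, ?_⟩
  · rw [conj_smul, hbc, map_inv₀, Complex.conj_ofReal]
  · rw [normForm_smul, hM]; field_simp
  · have hbb : b * b = (2 * (n + re p)) • p := by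
      rw [hb]
      simp only [mul_add, add_mul, Cayley.smul_mul, Cayley.mul_smul, Cayley.mul_one,
        Cayley.one_mul, hsq, hN]
      module
    rw [Cayley.smul_mul, Cayley.mul_smul, hbb, smul_smul, smul_smul, smul_smul]
    have : (n : ℂ) * (m : ℂ)⁻¹ * (m : ℂ)⁻¹ * (2 * (n + re p)) = 1 := by
      have h3 : (m : ℂ) ^ 2 = 2 * n * (n + re p) := by rw [← hM, hNb]
      field_simp
      linear_combination -h3
    rw [this, one_smul]

/-- Every complexified Cayley number is `p + i q` with `p`, `q` real. -/
theorem exists_real_imag (x : Cayley ℂ) :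
    ∃ p q : Cayley ℂ, conj p = p ∧ conj q = q ∧ x = p + Complex.I • q := by
  refine ⟨(2⁻¹ : ℂ) • (x + conj x), (-Complex.I * 2⁻¹) • (x - conj x), ?_, ?_, ?_⟩
  · rw [conj_smul, conj_add, conj_conj, add_comm, map_inv₀, map_ofNat]
  · rw [conj_smul, conj_sub, conj_conj, ← neg_sub x, smul_neg, map_mul, map_neg, map_inv₀, map_ofNat,
      Complex.conj_I, neg_neg, neg_mul, neg_smul]
  · rw [smul_smul, ← mul_assoc, mul_neg, Complex.I_mul_I]; module

theorem eq_zero_of_add_I_smul_eq_zero {p q : Cayley ℂ} (hp : conj p = p) (hq : conj q = q)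
    (h : p + Complex.I • q = 0) : p = 0 ∧ q = 0 := by
  have h' := congrArg conj h
  rw [conj_add, conj_smul, hp, hq, conj_zero, Complex.conj_I] at h'
  have e1 : (2 : ℂ) • p = 0 := by
    rw [show (2 : ℂ) • p = (p + Complex.I • q) + (p + -Complex.I • q) by module, h, h', add_zero]
  have hp0 : p = 0 := (smul_eq_zero.1 e1).resolve_left two_ne_zero
  rw [hp0, zero_add] at h
  exact ⟨hp0, (smul_eq_zero.1 h).resolve_left Complex.I_ne_zero⟩

/-- If `x ≠ 0` is null and `x̄ y = 0`, then `y` is a right multiple of `x` by a real Cayley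
number. -/
theorem exists_real_mul_eq {x y : Cayley ℂ} (hx : x ≠ 0) (hN : x * star x = 0)
    (hxy : star x * y = 0) : ∃ w, conj w = w ∧ y = x * w := by
  obtain ⟨p, q, hp, hq, rfl⟩ := exists_real_imag x
  obtain ⟨y₁, y₂, hy₁, hy₂, rfl⟩ := exists_real_imag y
  have cs : ∀ {z}, conj z = z → conj (star z) = star z := fun h => by rw [conj_star, h]
  have hs : star (p + Complex.I • q) = star p + Complex.I • star q := by
    rw [star_add, star_smul']
  have hII : ∀ z : Cayley ℂ, Complex.I • Complex.I • z = -z := fun z => by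
    rw [smul_smul, Complex.I_mul_I, neg_smul, one_smul]
  have h1 : p * star p - q * star q = 0 ∧ p * star q + q * star p = 0 := by
    apply eq_zero_of_add_I_smul_eq_zero
    · simp only [conj_sub, conj_mul, hp, hq, cs hp, cs hq]
    · simp only [conj_add, conj_mul, hp, hq, cs hp, cs hq]
    · rw [← hN, hs]
      simp only [mul_add, add_mul, Cayley.mul_smul, Cayley.smul_mul, hII, smul_add]
      abel
  have h2 : star p * y₁ - star q * y₂ = 0 ∧ star p * y₂ + star q * y₁ = 0 := by
    apply eq_zero_of_add_I_smul_eq_zero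
    · simp only [conj_sub, conj_mul, hy₁, hy₂, cs hp, cs hq]
    · simp only [conj_add, conj_mul, hy₁, hy₂, cs hp, cs hq]
    · rw [← hxy, hs]
      simp only [mul_add, add_mul, Cayley.mul_smul, Cayley.smul_mul, hII, smul_add]
      abel
  have hpq : normForm p = normForm q := congrArg re (sub_eq_zero.1 h1.1)
  obtain ⟨n, -, hn, hn0⟩ := exists_length hp
  obtain ⟨m, -, hm, hm0⟩ := exists_length hq
  -- `N(p) = N(q)` because `x` is null, and `N` is definite on real elements
  have hn1 : (n : ℂ) ≠ 0 := by
    intro h0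
    have h3 : (m : ℂ) ^ 2 = 0 := by rw [← hm, ← hpq, hn, h0]; simp
    have hm1 : m = 0 := by simpa using h3
    apply hx
    rw [hn0 (by exact_mod_cast h0), hm0 hm1]; simp
  -- `w = p⁻¹ y₁`; then `q w = y₂` by `p̄ y₁ = q̄ y₂`
  refine ⟨((n : ℂ) ^ 2)⁻¹ • (star p * y₁), ?_, ?_⟩
  · rw [conj_smul, conj_mul, cs hp, hy₁]; simp
  · rw [Cayley.mul_smul, add_mul, Cayley.smul_mul, mul_star_mul_cancel, sub_eq_zero.1 h2.1,
      mul_star_mul_cancel, ← hpq, hn, smul_add, smul_comm _ Complex.I,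
      inv_smul_smul₀ (pow_ne_zero 2 hn1), inv_smul_smul₀ (pow_ne_zero 2 hn1)]

end Cayley

open Cayley

namespace J

/-! ### Coordinates on the complexified Jordan algebra -/

/-- The diagonal coordinate `ξᵢ` of `X`, as a scalar. -/
def dg (X : J ℂ) (i : Fin 3) : ℂ := (X.1 i i).re

/-- The off-diagonal coordinate `xᵢ` of `X`, the entry at `(i + 1, i + 2)` (indices mod 3). -/
def od (X : J ℂ) (i : Fin 3) : Cayley ℂ := X.1 (i + 1) (i + 2)

theorem star_entry (X : J ℂ) (i j : Fin 3) : star (X.1 i j) = X.1 j i :=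
  congrFun (congrFun X.2 j) i

theorem entry_diag (X : J ℂ) (i : Fin 3) : X.1 i i = dg X i • 1 := by
  have h := add_star_self (X.1 i i)
  rw [star_entry, ← two_smul ℂ, ← smul_smul] at h
  exact smul_right_injective _ (two_ne_zero (α := ℂ)) h

theorem entry_two_one (X : J ℂ) : X.1 2 1 = star (od X 0) := (star_entry X 1 2).symm
theorem entry_zero_two (X : J ℂ) : X.1 0 2 = star (od X 1) := (star_entry X 2 0).symm
theorem entry_one_zero (X : J ℂ) : X.1 1 0 = star (od X 2) := (star_entry X 0 1).symm
theorem entry_one_two (X : J ℂ) : X.1 1 2 = od X 0 := rfl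
theorem entry_two_zero (X : J ℂ) : X.1 2 0 = od X 1 := rfl
theorem entry_zero_one (X : J ℂ) : X.1 0 1 = od X 2 := rfl

theorem ext_coord {X Y : J ℂ} (hd : ∀ i, dg X i = dg Y i) (ho : ∀ i, od X i = od Y i) :
    X = Y := by
  apply Subtype.ext
  ext1 i j
  fin_cases i <;> fin_cases j <;>
    simp [entry_diag, hd, ho, entry_two_one, entry_zero_two, entry_one_zero, entry_one_two,
      entry_two_zero, entry_zero_one]

section coord

variable (X Y : J ℂ) (c : ℂ) (i : Fin 3)
@[simp] theorem dg_add : dg (X + Y) i = dg X i + dg Y i := rfl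
@[simp] theorem od_add : od (X + Y) i = od X i + od Y i := rfl
@[simp] theorem dg_sub : dg (X - Y) i = dg X i - dg Y i := rfl
@[simp] theorem od_sub : od (X - Y) i = od X i - od Y i := rfl
@[simp] theorem dg_smul : dg (c • X) i = c * dg X i := rfl
@[simp] theorem od_smul : od (c • X) i = c • od X i := rfl
@[simp] theorem dg_zero : dg 0 i = 0 := rfl
@[simp] theorem od_zero : od 0 i = 0 := rfl
@[simp] theorem dg_E : dg E i = 1 := by simp [dg, E]
@[simp] theorem od_E : od E i = 0 := by
  fin_cases i <;> simp [od, E]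
@[simp] theorem dg_tau : dg (tau X) i = starRingEnd ℂ (dg X i) := rfl
@[simp] theorem od_tau : od (tau X) i = conj (od X i) := rfl
theorem dg_idem (k : Fin 3) : dg (idem k) i = if k = i then 1 else 0 := by
  by_cases h : k = i <;> simp [dg, idem, h]
@[simp] theorem od_idem (k : Fin 3) : od (idem k) i = 0 := by
  fin_cases i <;> fin_cases k <;> simp [od, idem, Matrix.single]

theorem jmul_entry (i j : Fin 3) : (jmul X Y).1 i j =
    (2⁻¹ : ℂ) • (∑ k, X.1 i k * Y.1 k j + ∑ k, Y.1 i k * X.1 k j) := rfl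

theorem tr_eq : tr X = ∑ i, dg X i := rfl

theorem dg_jmul : dg (jmul X Y) i = dg X i * dg Y i +
    re (od X (i + 1) * star (od Y (i + 1))) + re (od X (i + 2) * star (od Y (i + 2))) := by
  have h : ∀ x y : Cayley ℂ, re (star x * y) = re (y * star x) := fun x y => re_mul_comm _ _
  have h' : ∀ x y : Cayley ℂ, re (x * star y) = re (y * star x) := fun x y => by
    rw [← re_star, star_mul, star_star]
  rw [dg, jmul_entry]
  fin_cases i <;>
    simp [Fin.sum_univ_three, entry_diag, entry_two_one, entry_zero_two, entry_one_zero,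
      entry_one_two, entry_two_zero, entry_zero_one, h, Cayley.mul_smul,
      Cayley.mul_one, h' (od Y _) (od X _)] <;> ring

theorem od_jmul : od (jmul X Y) i = (2⁻¹ : ℂ) • ((dg X (i + 1) + dg X (i + 2)) • od Y i +
    (dg Y (i + 1) + dg Y (i + 2)) • od X i +
    star (od X (i + 1) * od Y (i + 2) + od Y (i + 1) * od X (i + 2))) := by
  rw [od, jmul_entry]
  congr 1
  fin_cases i <;>
    simp [Fin.sum_univ_three, entry_diag, entry_two_one, entry_zero_two, entry_one_zero,
      entry_one_two, entry_two_zero, entry_zero_one, Cayley.smul_mul, Cayley.mul_smul,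
      Cayley.mul_one, Cayley.one_mul] <;> module

theorem bilin_eq : bilin X Y = ∑ i, (dg X i * dg Y i + 2 * re (od X i * star (od Y i))) := by
  rw [bilin, tr_eq]
  simp [Fin.sum_univ_three, dg_jmul]
  ring

theorem herm_eq : herm X Y = ∑ i, (starRingEnd ℂ (dg X i) * dg Y i +
    2 * re (conj (od X i) * star (od Y i))) := bilin_eq _ _

theorem dg_cross : dg (cross X Y) i = (2⁻¹ : ℂ) * (dg X (i + 1) * dg Y (i + 2) +
    dg X (i + 2) * dg Y (i + 1) - 2 * re (od X i * star (od Y i))) := by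
  rw [cross]
  simp only [dg_smul, dg_add, dg_sub, dg_jmul, dg_E, bilin_eq, tr_eq, Fin.sum_univ_three]
  fin_cases i <;> simp <;> ring

theorem od_cross : od (cross X Y) i = (2⁻¹ : ℂ) • (
    star (od X (i + 1) * od Y (i + 2) + od Y (i + 1) * od X (i + 2)) -
    dg X i • od Y i - dg Y i • od X i) := by
  rw [cross]
  simp only [od_smul, od_add, od_sub, od_jmul, od_E, tr_eq, Fin.sum_univ_three]
  congr 1
  fin_cases i <;> simp <;> module

end coord

/-- An automorphism of the Jordan algebra `𝔍` (extended to `𝔍^ℂ`) belongs to `E₆`. -/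
theorem mem_E6_of_jmul {α : J ℂ ≃ₗ[ℂ] J ℂ} (hj : ∀ X Y, jmul (α X) (α Y) = α (jmul X Y))
    (ht : ∀ X, tr (α X) = tr X) (hE : α E = E) (hτ : ∀ X, tau (α X) = α (tau X)) : α ∈ E6 := by
  refine ⟨fun X Y => ?_, fun X Y => ?_⟩
  · rw [hτ, tau_tau]
    simp only [cross, bilin, hj, ht, map_smul, map_add, map_sub, hE]
  · rw [herm, herm, hτ, bilin, bilin, hj, ht]

/-! ### Orthogonal congruences -/

/-- The map `M ↦ V M Vᵀ` for a scalar matrix `V`, written out because matrices over the Cayley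
algebra do not form an associative ring. -/
def congr (V : Matrix (Fin 3) (Fin 3) ℂ) (M : Matrix (Fin 3) (Fin 3) (Cayley ℂ)) :
    Matrix (Fin 3) (Fin 3) (Cayley ℂ) :=
  Matrix.of fun i j => ∑ k, ∑ l, (V i k * V j l) • M k l

theorem congr_apply (V : Matrix (Fin 3) (Fin 3) ℂ) (M i j) :
    congr V M i j = ∑ k, ∑ l, (V i k * V j l) • M k l := rfl

/-- Invariance of the trace under `V · Vᵀ`, for a matrix `F` of Cayley numbers. -/
theorem sum_mul_smul_of_orthogonal {V : Matrix (Fin 3) (Fin 3) ℂ} (hV : V.transpose * V = 1)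
    (F : Fin 3 → Fin 3 → Cayley ℂ) :
    ∑ i, ∑ k, ∑ l, (V i k * V i l) • F k l = ∑ k, F k k := by
  have h : ∀ k l, ∑ i, V i k * V i l = if k = l then 1 else 0 := fun k l => by
    rw [← Matrix.one_apply, ← hV]; rfl
  rw [Finset.sum_comm]
  refine Finset.sum_congr rfl fun k _ => ?_
  rw [Finset.sum_comm]
  simp only [← Finset.sum_smul, h]
  simp

/-- Since scalars associate with all Cayley numbers, `V · Vᵀ` is multiplicative for orthogonal
`V`. -/
theorem congr_mul {V : Matrix (Fin 3) (Fin 3) ℂ} (hV : V.transpose * V = 1)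
    (M N : Matrix (Fin 3) (Fin 3) (Cayley ℂ)) : congr V M * congr V N = congr V (M * N) := by
  ext1 i j
  have h : ∀ m, congr V M i m * congr V N m j = ∑ k, ∑ l, (V m k * V m l) •
      ((∑ a, V i a • M a k) * ∑ b, V j b • N l b) := by
    intro m
    have h1 : congr V M i m = ∑ k, V m k • ∑ a, V i a • M a k := by
      rw [congr_apply, Finset.sum_comm]
      simp only [Finset.smul_sum, smul_smul, mul_comm]
    have h2 : congr V N m j = ∑ k, V m k • ∑ a, V j a • N k a := by
      rw [congr_apply]
      simp only [Finset.smul_sum, smul_smul]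
    rw [h1, h2, Finset.sum_mul_sum]
    refine Finset.sum_congr rfl fun k _ => Finset.sum_congr rfl fun l _ => ?_
    rw [Cayley.smul_mul, Cayley.mul_smul, smul_smul]
  rw [Matrix.mul_apply, Finset.sum_congr rfl fun m _ => h m, sum_mul_smul_of_orthogonal hV, congr_apply]
  simp only [Fin.sum_univ_three, Matrix.mul_apply, mul_add, add_mul, Cayley.smul_mul,
    Cayley.mul_smul]
  module

theorem congr_congr (V W : Matrix (Fin 3) (Fin 3) ℂ) (M) :
    congr V (congr W M) = congr (V * W) M := by
  ext1 i j
  simp only [congr_apply, Matrix.mul_apply, Fin.sum_univ_three]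
  module

theorem congr_one (M) : congr 1 M = M := by
  ext1 i j
  simp [congr_apply, Matrix.one_apply]

theorem congr_add (V M N) : congr V (M + N) = congr V M + congr V N := by
  ext1 i j
  simp [congr_apply, Finset.sum_add_distrib]

theorem congr_smul (V) (c : ℂ) (M) : congr V (c • M) = c • congr V M := by
  ext1 i j
  simp [congr_apply, Finset.smul_sum, smul_smul, mul_comm]

theorem congr_conjTranspose (V M) : (congr V M).conjTranspose = congr V M.conjTranspose := by
  ext1 i j
  simp only [congr_apply, Matrix.conjTranspose_apply, star_sum, star_smul']
  rw [Finset.sum_comm]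
  simp only [mul_comm]

/-- The congruence `X ↦ V X Vᵀ` of `𝔍^ℂ` by a complex orthogonal matrix `V`. -/
def orth (V : Matrix (Fin 3) (Fin 3) ℂ) (hV : V.transpose * V = 1) : J ℂ ≃ₗ[ℂ] J ℂ where
  toFun X := ⟨congr V X.1, (congr_conjTranspose V X.1).trans (by rw [show _ = _ from X.2])⟩
  invFun X := ⟨congr V.transpose X.1,
    (congr_conjTranspose _ X.1).trans (by rw [show _ = _ from X.2])⟩
  map_add' X Y := Subtype.ext (congr_add _ _ _)
  map_smul' c X := Subtype.ext (congr_smul _ _ _)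
  left_inv X := Subtype.ext (by simp only [congr_congr, hV, congr_one])
  right_inv X := Subtype.ext (by
    simp only [congr_congr, mul_eq_one_comm.1 hV, congr_one])

theorem coe_orth {V : Matrix (Fin 3) (Fin 3) ℂ} (hV : V.transpose * V = 1) (X : J ℂ) :
    (orth V hV X).1 = congr V X.1 := rfl

/-- Real orthogonal congruences are automorphisms of `𝔍`. -/
theorem orth_mem_E6 {V : Matrix (Fin 3) (Fin 3) ℂ} (hV : V.transpose * V = 1)
    (hr : ∀ i j, starRingEnd ℂ (V i j) = V i j) : orth V hV ∈ E6 := by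
  apply mem_E6_of_jmul
  · intro X Y
    apply Subtype.ext
    rw [coe_orth]
    change (2⁻¹ : ℂ) • (congr V X.1 * congr V Y.1 + congr V Y.1 * congr V X.1) =
      congr V ((2⁻¹ : ℂ) • (X.1 * Y.1 + Y.1 * X.1))
    rw [congr_smul, congr_add, congr_mul hV, congr_mul hV]
  · intro X
    have h := congrArg re (sum_mul_smul_of_orthogonal hV X.1)
    simpa [tr, Fin.sum_univ_three, coe_orth, congr_apply] using h
  · apply Subtype.ext
    rw [coe_orth]
    ext1 i j
    have h : (V * V.transpose) i j = (1 : Matrix (Fin 3) (Fin 3) ℂ) i j := by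
      rw [mul_eq_one_comm.1 hV]
    change congr V 1 i j = (1 : Matrix (Fin 3) (Fin 3) (Cayley ℂ)) i j
    rw [congr_apply]
    simp only [Matrix.one_apply, Matrix.mul_apply, Matrix.transpose_apply, smul_ite, smul_zero,
      Finset.sum_ite_eq, Finset.mem_univ, if_true, ← Finset.sum_smul] at h ⊢
    rw [h]; split_ifs <;> simp
  · intro X
    apply Subtype.ext
    ext1 i j
    change conj (congr V X.1 i j) = congr V (X.1.map conj) i j
    simp only [congr_apply, Fin.sum_univ_three, conj_add, conj_smul, map_mul, hr,
      Matrix.map_apply]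

/-! ### Maps acting separately on each coordinate -/

/-- The linear map `ξᵢ ↦ zᵢ ξᵢ`, `xᵢ ↦ fᵢ xᵢ`. -/
def coordMap (z : Fin 3 → ℂ) (f : Fin 3 → Cayley ℂ →ₗ[ℂ] Cayley ℂ) : J ℂ →ₗ[ℂ] J ℂ where
  toFun X := ⟨!![(z 0 * dg X 0) • 1, f 2 (od X 2), star (f 1 (od X 1));
      star (f 2 (od X 2)), (z 1 * dg X 1) • 1, f 0 (od X 0);
      f 1 (od X 1), star (f 0 (od X 0)), (z 2 * dg X 2) • 1], by
    change Matrix.conjTranspose _ = _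
    ext1 i j
    fin_cases i <;> fin_cases j <;> simp [star_smul', star_one']⟩
  map_add' X Y := by
    apply ext_coord <;> intro i <;> fin_cases i <;>
      simp [dg, od, mul_add]
  map_smul' c X := by
    apply ext_coord <;> intro i <;> fin_cases i <;>
      simp [dg, od, mul_left_comm]

theorem dg_coordMap (z f X) (i) : dg (coordMap z f X) i = z i * dg X i := by
  fin_cases i <;> simp [dg, coordMap]

theorem od_coordMap (z f X) (i) : od (coordMap z f X) i = f i (od X i) := by
  fin_cases i <;> simp [od, coordMap]

/-- `coordMap` as a linear automorphism, for invertible `zᵢ` and `fᵢ`. -/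
noncomputable def coordEquiv (z : Fin 3 → ℂˣ) (f : Fin 3 → Cayley ℂ ≃ₗ[ℂ] Cayley ℂ) : J ℂ ≃ₗ[ℂ] J ℂ :=
  LinearEquiv.ofLinearMap (coordMap (fun i => z i) fun i => f i)
    (coordMap (fun i => (z i)⁻¹) fun i => (f i).symm)
    (LinearMap.ext fun X => ext_coord (by simp [dg_coordMap]) (by simp [od_coordMap]))
    (LinearMap.ext fun X => ext_coord (by simp [dg_coordMap]) (by simp [od_coordMap]))

theorem coordEquiv_apply (z : Fin 3 → ℂˣ) (f : Fin 3 → Cayley ℂ ≃ₗ[ℂ] Cayley ℂ) (X) :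
    coordEquiv z f X = coordMap (fun i => z i) (fun i => f i) X := rfl

theorem dg_coordEquiv (z : Fin 3 → ℂˣ) (f : Fin 3 → Cayley ℂ ≃ₗ[ℂ] Cayley ℂ) (X i) :
    dg (coordEquiv z f X) i = z i * dg X i := by
  rw [coordEquiv_apply, dg_coordMap]

theorem od_coordEquiv (z : Fin 3 → ℂˣ) (f : Fin 3 → Cayley ℂ ≃ₗ[ℂ] Cayley ℂ) (X i) :
    od (coordEquiv z f X) i = f i (od X i) := by
  rw [coordEquiv_apply, od_coordMap]; rfl

/-- The hypotheses express invariance of each term of the Freudenthal product and of the Hermitian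
form in coordinates; the expression `conj (f (conj x))` stands for `τ f τ`. -/
theorem coordEquiv_mem_E6 {z : Fin 3 → ℂˣ} {f : Fin 3 → Cayley ℂ ≃ₗ[ℂ] Cayley ℂ}
    (hz : ∀ i, (z (i + 1) * z (i + 2) : ℂ) = starRingEnd ℂ (z i))
    (hz1 : ∀ i, starRingEnd ℂ (z i) * z i = 1)
    (hre : ∀ i x y, re (f i x * star (f i y)) = starRingEnd ℂ (z i) * re (x * star y))
    (hf : ∀ i x y, f (i + 1) x * f (i + 2) y = star (conj (f i (conj (star (x * y))))))
    (hzf : ∀ i x, (z i : ℂ) • f i x = conj (f i (conj x)))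
    (hh : ∀ i x y, re (conj (f i x) * star (f i y)) = re (conj x * star y)) :
    coordEquiv z f ∈ E6 := by
  refine ⟨fun X Y => ext_coord (fun i => ?_) fun i => ?_, fun X Y => ?_⟩
  · simp only [dg_cross, dg_tau, dg_coordEquiv, od_coordEquiv, hre, map_mul, Complex.conj_conj,
      mul_assoc]
    simp only [← hz]
    ring
  · simp only [od_cross, od_tau, od_coordEquiv, dg_coordEquiv, hf]
    simp only [Cayley.conj_smul, conj_sub, conj_add, star_add, map_add, map_sub, map_smul,
      star_star, Complex.conj_conj, mul_comm (z i : ℂ), ← smul_smul, hzf]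
  · simp only [herm_eq, dg_coordEquiv, od_coordEquiv, hh]
    refine Finset.sum_congr rfl fun i _ => ?_
    rw [map_mul]
    linear_combination (starRingEnd ℂ (dg X i) * dg Y i) * hz1 i

theorem mem_Spin10_coordEquiv {z : Fin 3 → ℂˣ} {f : Fin 3 → Cayley ℂ ≃ₗ[ℂ] Cayley ℂ} {k : Fin 3}
    (h : coordEquiv z f ∈ E6) (hk : z k = 1) : coordEquiv z f ∈ Spin10 k := by
  refine ⟨h, ext_coord (fun i => ?_) fun i => ?_⟩
  · rw [dg_coordEquiv, dg_idem]
    split_ifs with hi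
    · rw [← hi, hk]; simp
    · simp
  · rw [od_coordEquiv, od_idem, map_zero]

/-! ### Rotations, phases and triality elements -/

/-- The rotation by `(c, s)` in the plane of the last two coordinates. -/
theorem exists_rotation {c s : ℝ} (hcs : c ^ 2 + s ^ 2 = 1) : ∃ g ∈ Spin10 0, ∀ X,
    dg (g X) 1 = c ^ 2 * dg X 1 + s ^ 2 * dg X 2 + 2 * c * s * re (od X 0) ∧
    dg (g X) 2 = s ^ 2 * dg X 1 + c ^ 2 * dg X 2 - 2 * c * s * re (od X 0) ∧
    od (g X) 0 = (c ^ 2 : ℂ) • od X 0 - (s ^ 2 : ℂ) • star (od X 0) +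
      (c * s * (dg X 2 - dg X 1)) • 1 ∧
    od (g X) 2 = (c : ℂ) • od X 2 + (s : ℂ) • star (od X 1) := by
  have hcs' : (c : ℂ) ^ 2 + (s : ℂ) ^ 2 = 1 := by exact_mod_cast hcs
  set V : Matrix (Fin 3) (Fin 3) ℂ := !![1, 0, 0; 0, c, s; 0, -s, c] with hVdef
  have hV : V.transpose * V = 1 := by
    ext i j
    fin_cases i <;> fin_cases j <;> simp [hVdef, Matrix.mul_apply, Fin.sum_univ_three] <;>
      first | ring1 | linear_combination hcs'
  have hr : ∀ i j, starRingEnd ℂ (V i j) = V i j := by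
    intro i j
    fin_cases i <;> fin_cases j <;> simp [hVdef]
  refine ⟨orth V hV, ⟨orth_mem_E6 hV hr, ?_⟩, fun X => ⟨?_, ?_, ?_, ?_⟩⟩
  · apply Subtype.ext
    ext1 i j
    rw [coe_orth]
    fin_cases i <;> fin_cases j <;>
      simp [congr_apply, Fin.sum_univ_three, hVdef, idem]
  · rw [dg, coe_orth]
    simp [congr_apply, Fin.sum_univ_three, hVdef, entry_diag, entry_two_one, entry_one_two]
    ring
  · rw [dg, coe_orth]
    simp [congr_apply, Fin.sum_univ_three, hVdef, entry_diag, entry_two_one, entry_one_two]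
    ring
  · rw [od, coe_orth]
    simp [congr_apply, Fin.sum_univ_three, hVdef, entry_diag, entry_two_one, entry_one_two]
    module
  · rw [od, coe_orth]
    simp [congr_apply, Fin.sum_univ_three, hVdef, entry_zero_one, entry_zero_two]

/-- The cyclic permutation of the coordinates. -/
theorem exists_shift : ∃ σ ∈ E6, ∀ X : J ℂ, (∀ i, dg (σ X) i = dg X (i + 1)) ∧
    ∀ i, od (σ X) i = od X (i + 1) := by
  set V : Matrix (Fin 3) (Fin 3) ℂ := !![0, 1, 0; 0, 0, 1; 1, 0, 0] with hVdef
  have hV : V.transpose * V = 1 := by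
    ext i j
    fin_cases i <;> fin_cases j <;> simp [hVdef, Matrix.mul_apply, Fin.sum_univ_three]
  have hr : ∀ i j, starRingEnd ℂ (V i j) = V i j := by
    intro i j
    fin_cases i <;> fin_cases j <;> simp [hVdef]
  refine ⟨orth V hV, orth_mem_E6 hV hr, fun X => ⟨fun i => ?_, fun i => ?_⟩⟩
  · rw [dg, coe_orth]
    fin_cases i <;> simp [congr_apply, Fin.sum_univ_three, hVdef, dg]
  · rw [od, coe_orth]
    fin_cases i <;> simp [congr_apply, Fin.sum_univ_three, hVdef, od]

/-- The congruence `X ↦ D X D` by `D = diag(u₀, u₁, u₂)` in `SU(3)`. -/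
theorem exists_phase {u : Fin 3 → ℂ} (hu : ∀ i, starRingEnd ℂ (u i) * u i = 1)
    (hprod : u 0 * u 1 * u 2 = 1) {k : Fin 3} (hk : u k = 1) : ∃ g ∈ Spin10 k, ∀ X,
    (∀ i, dg (g X) i = u i ^ 2 * dg X i) ∧
    ∀ i, od (g X) i = (u (i + 1) * u (i + 2)) • od X i := by
  set v : Fin 3 → ℂˣ := fun i => ⟨u i, starRingEnd ℂ (u i), by rw [mul_comm, hu], hu i⟩ with hv
  have hvu : ∀ i, (v i : ℂ) = u i := fun i => rfl
  have hp : ∀ i, u i * (u (i + 1) * u (i + 2)) = 1 := by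
    intro i
    rw [← hprod]
    fin_cases i <;> simp <;> ring
  have hc : ∀ i, u (i + 1) * u (i + 2) = starRingEnd ℂ (u i) := fun i => by
    linear_combination (starRingEnd ℂ (u i)) * hp i - (u (i + 1) * u (i + 2)) * hu i
  set f : Fin 3 → Cayley ℂ ≃ₗ[ℂ] Cayley ℂ := fun i =>
    LinearEquiv.smulOfUnit (v (i + 1) * v (i + 2)) with hf
  have hfx : ∀ i x, f i x = starRingEnd ℂ (u i) • x := fun i x => by rw [← hc]; rfl
  refine ⟨coordEquiv (fun i => v i ^ 2) f, mem_Spin10_coordEquiv (coordEquiv_mem_E6 ?_ ?_ ?_ ?_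
    ?_ ?_) ?_, fun X => ⟨fun i => ?_, fun i => ?_⟩⟩
  · intro i
    simp only [Units.val_pow_eq_pow_val, hvu, map_pow, ← hc]; ring
  · intro i
    simp only [Units.val_pow_eq_pow_val, hvu, map_pow]
    rw [← mul_pow, hu, one_pow]
  · intro i x y
    simp only [hfx, star_smul', Cayley.smul_mul, Cayley.mul_smul, re_smul,
      Units.val_pow_eq_pow_val, hvu, map_pow]
    ring
  · intro i x y
    simp only [hfx, star_smul', Cayley.smul_mul, Cayley.mul_smul, Cayley.conj_smul,
      conj_conj, star_star, Complex.conj_conj, smul_smul]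
    congr 1
    have h1 := hc (i + 1)
    have h2 := hc (i + 2)
    rw [← h1, ← h2]
    have e1 : i + 1 + 1 = i + 2 := by fin_cases i <;> rfl
    have e2 : i + 1 + 2 = i := by fin_cases i <;> rfl
    have e3 : i + 2 + 1 = i := by fin_cases i <;> rfl
    have e4 : i + 2 + 2 = i + 1 := by fin_cases i <;> rfl
    rw [e1, e2, e3, e4]
    linear_combination u i * hp i
  · intro i x
    simp only [hfx, Cayley.conj_smul, conj_conj, smul_smul, Units.val_pow_eq_pow_val, hvu,
      Complex.conj_conj]
    congr 1
    linear_combination u i * hu i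
  · intro i x y
    simp only [hfx, star_smul', Cayley.smul_mul, Cayley.mul_smul, Cayley.conj_smul, re_smul,
      Complex.conj_conj]
    linear_combination (re (conj x * star y)) * hu i
  · ext
    simp [hvu, hk]
  · rw [dg_coordEquiv]; rfl
  · rw [od_coordEquiv]; rfl

/-- Left multiplication by a Cayley number of norm one. -/
def mulLeft {a : Cayley ℂ} (ha : normForm a = 1) : Cayley ℂ ≃ₗ[ℂ] Cayley ℂ where
  toFun x := a * x
  invFun x := star a * x
  map_add' := mul_add a
  map_smul' c x := Cayley.mul_smul c a x
  left_inv x := by simp only [star_mul_mul_cancel, ha, one_smul]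
  right_inv x := by simp only [mul_star_mul_cancel, ha, one_smul]

/-- Right multiplication by a Cayley number of norm one. -/
def mulRight {a : Cayley ℂ} (ha : normForm a = 1) : Cayley ℂ ≃ₗ[ℂ] Cayley ℂ where
  toFun x := x * a
  invFun x := x * star a
  map_add' x y := add_mul x y a
  map_smul' c x := Cayley.smul_mul c x a
  left_inv x := by simp only [mul_mul_star_cancel, ha, one_smul]
  right_inv x := by simp only [mul_star_mul_self_cancel, ha, one_smul]

theorem re_mul_assoc (x y z : Cayley ℂ) : re ((x * y) * z) = re (x * (y * z)) := by
  simp [re]; ring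

theorem re_mul_left_mul_star {a : Cayley ℂ} (ha : normForm a = 1) (x y : Cayley ℂ) :
    re ((a * x) * star (a * y)) = re (x * star y) := by
  rw [re_mul_comm, star_mul, re_mul_assoc, star_mul_mul_cancel, ha, one_smul, re_mul_comm]

theorem re_mul_right_mul_star {a : Cayley ℂ} (ha : normForm a = 1) (x y : Cayley ℂ) :
    re ((x * a) * star (y * a)) = re (x * star y) := by
  rw [star_mul, ← re_mul_assoc, mul_mul_star_cancel, ha, one_smul]

/-- The triality element of a real unit `a`; it fixes the diagonal, so lies in every `Spin10 k`. -/
theorem exists_triality {a : Cayley ℂ} (hac : conj a = a) (ha : normForm a = 1) (k : Fin 3) :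
    ∃ g ∈ Spin10 k, ∀ X, (∀ i, dg (g X) i = dg X i) ∧
      od (g X) 0 = (star a * od X 0) * star a ∧ od (g X) 1 = a * od X 1 ∧
      od (g X) 2 = od X 2 * a := by
  have hs : normForm (star a) = 1 := by rw [normForm_star, ha]
  have hsc : conj (star a) = star a := by rw [conj_star, hac]
  set f : Fin 3 → Cayley ℂ ≃ₗ[ℂ] Cayley ℂ :=
    ![(mulLeft hs).trans (mulRight hs), mulLeft ha, mulRight ha] with hf
  have f0 : ∀ x, f 0 x = (star a * x) * star a := fun x => rfl
  have f1 : ∀ x, f 1 x = a * x := fun x => rfl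
  have f2 : ∀ x, f 2 x = x * a := fun x => rfl
  have hfc : ∀ i x, conj (f i x) = f i (conj x) := by
    intro i x
    fin_cases i
    · simp [f0, conj_mul, hsc]
    · simp [f1, conj_mul, hac]
    · simp [f2, conj_mul, hac]
  have hre : ∀ i x y, re (f i x * star (f i y)) = re (x * star y) := by
    have h1 := fun x y => re_mul_left_mul_star ha x y
    have h2 := fun x y => re_mul_right_mul_star hs x y
    have h3 := fun x y => re_mul_right_mul_star ha x y
    have h4 := fun x y => re_mul_left_mul_star hs x y
    intro i x y
    fin_cases i
    · simp only [Fin.zero_eta, f0]; rw [h2, h4]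
    · exact h1 x y
    · exact h3 x y
  refine ⟨coordEquiv (fun _ => 1) f, mem_Spin10_coordEquiv (coordEquiv_mem_E6 ?_ ?_ ?_ ?_
    ?_ ?_) rfl, fun X => ⟨fun i => ?_, ?_, ?_, ?_⟩⟩
  · simp
  · simp
  · simp [hre]
  · intro i x y
    rw [← hfc, conj_conj]
    fin_cases i
    · change f 1 x * f 2 y = star (f 0 (star (x * y)))
      rw [f0, f1, f2, triality_mid ha, star_mul, star_mul, star_star, star_star, flexible]
    · change f 2 x * f 0 y = star (f 1 (star (x * y)))
      rw [f0, f1, f2, triality_right ha, star_mul, star_star]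
    · change f 0 x * f 1 y = star (f 2 (star (x * y)))
      rw [f0, f1, f2, triality_left ha, star_mul, star_star]
  · intro i x
    rw [← hfc, conj_conj]; simp
  · intro i x y
    rw [hfc, hre]
  · rw [dg_coordEquiv]; simp
  · rw [od_coordEquiv, f0]
  · rw [od_coordEquiv, f1]
  · rw [od_coordEquiv, f2]

/-! ### Reduction of elements of rank one -/

/-- With `c = cos θ`, `s = sin θ` the equation reads `cos 2θ · α + sin 2θ · β / 2 = 0`. -/
theorem exists_double_angle (α β : ℝ) :
    ∃ c s : ℝ, c ^ 2 + s ^ 2 = 1 ∧ (c ^ 2 - s ^ 2) * α + c * s * β = 0 := by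
  set h : ℝ → ℝ := fun θ => (Real.cos θ ^ 2 - Real.sin θ ^ 2) * α +
    Real.cos θ * Real.sin θ * β with hh
  have hc : Continuous h := by fun_prop
  have h0 : h 0 = α := by simp [hh]
  have h1 : h (Real.pi / 2) = -α := by simp [hh]
  obtain ⟨θ, -, hθ⟩ : (0 : ℝ) ∈ h '' Set.uIcc 0 (Real.pi / 2) := by
    apply intermediate_value_uIcc hc.continuousOn
    rw [h0, h1, Set.mem_uIcc]
    rcases le_total 0 α with h | h
    · right; constructor <;> linarith
    · left; constructor <;> linarith
  exact ⟨Real.cos θ, Real.sin θ, Real.cos_sq_add_sin_sq θ, hθ⟩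

/-- The square of a phase rotates `z` to the nonnegative real axis. -/
theorem exists_unit_mul (z : ℂ) : ∃ u : ℂ, starRingEnd ℂ u * u = 1 ∧ ∃ ρ : ℝ, 0 ≤ ρ ∧
    u ^ 2 * z = ρ := by
  refine ⟨Complex.exp (((-z.arg / 2 : ℝ) : ℂ) * Complex.I), ?_, ‖z‖, norm_nonneg z, ?_⟩
  · rw [← Complex.normSq_eq_conj_mul_self, Complex.normSq_eq_norm_sq,
      Complex.norm_exp_ofReal_mul_I]
    simp
  · rw [← Complex.exp_nat_mul]
    nth_rw 2 [← Complex.norm_mul_exp_arg_mul_I z]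
    rw [mul_left_comm, ← Complex.exp_add]
    have : ((2 : ℕ) : ℂ) * (((-z.arg / 2 : ℝ) : ℂ) * Complex.I) + z.arg * Complex.I = 0 := by
      push_cast; ring
    rw [this, Complex.exp_zero, mul_one]

/-- The equation `A × A = 0` (rank at most one) is invariant under `E₆`. -/
theorem cross_self_eq_zero {g : J ℂ ≃ₗ[ℂ] J ℂ} (hg : g ∈ E6) {A : J ℂ} (hA : cross A A = 0) :
    cross (g A) (g A) = 0 := by
  have h0 : tau 0 = 0 := ext_coord (fun i => map_zero _) fun i => conj_zero
  rw [hg.1, hA, h0, map_zero, h0]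

theorem dg_mul_dg {A : J ℂ} (hA : cross A A = 0) (i : Fin 3) :
    dg A (i + 1) * dg A (i + 2) = normForm (od A i) := by
  have h := dg_cross A A i
  rw [hA, dg_zero] at h
  rw [normForm]
  linear_combination -h

theorem star_od_mul_od {A : J ℂ} (hA : cross A A = 0) (i : Fin 3) :
    star (od A (i + 1) * od A (i + 2)) = dg A i • od A i := by
  have h := od_cross A A i
  rw [hA, od_zero, ← two_smul ℂ (_ * _), star_smul', sub_sub, ← two_smul ℂ,
    ← smul_sub, smul_smul, inv_mul_cancel₀ two_ne_zero, one_smul] at h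
  exact sub_eq_zero.1 h.symm

theorem star_mul_sq_mul_star {a : Cayley ℂ} (ha : normForm a = 1) :
    (star a * (a * a)) * star a = 1 := by
  rw [star_mul_mul_cancel, ha, one_smul, mul_star_self, ha, one_smul]

/-- A triality element makes the real part of `x₀` a scalar. -/
theorem exists_re_od_zero_scalar (A : J ℂ) : ∃ g ∈ Spin10 0, ∃ (r : ℝ) (q : Cayley ℂ),
    conj q = q ∧ od (g A) 0 = (r : ℂ) • 1 + Complex.I • q := by
  obtain ⟨p, q, hp, hq, h⟩ := exists_real_imag (od A 0)
  obtain ⟨a, hac, ha, r, rfl⟩ := exists_unit_sq hp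
  obtain ⟨g, hg, hgX⟩ := exists_triality hac ha 0
  refine ⟨g, hg, r, (star a * q) * star a, ?_, ?_⟩
  · rw [conj_mul, conj_mul, conj_star, hac, hq]
  · rw [(hgX A).2.1, h, mul_add, add_mul, Cayley.mul_smul, Cayley.smul_mul, Cayley.mul_smul,
      Cayley.smul_mul, star_mul_sq_mul_star ha]

theorem re_real {q : Cayley ℂ} (hq : conj q = q) : re q = ((re q).re : ℂ) := by
  have h := congrArg re hq
  rw [re_conj] at h
  exact (Complex.conj_eq_iff_re.1 h).symm

/-- Once the real part of `x₀` is a scalar, a rotation moves it into the diagonal; a second triality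
element makes the remaining imaginary part a scalar. -/
theorem exists_od_zero_imag (A : J ℂ) : ∃ g ∈ Spin10 0, ∃ r : ℝ,
    od (g A) 0 = (Complex.I * r) • 1 := by
  obtain ⟨g₁, hg₁, r, q, hq, h₁⟩ := exists_re_od_zero_scalar A
  set B := g₁ A with hB
  obtain ⟨c, s, hcs, h⟩ := exists_double_angle r (dg B 2 - dg B 1).re
  obtain ⟨g₂, hg₂, h₂⟩ := exists_rotation hcs
  have hcs' : (c : ℂ) ^ 2 + (s : ℂ) ^ 2 = 1 := by exact_mod_cast hcs
  have hq2 : star q = ((2 * (re q).re : ℝ) : ℂ) • 1 - q := by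
    rw [star_eq]; push_cast; rw [← re_real hq]
  -- after the rotation the real part of `x₀` vanishes
  have hod : od (g₂ B) 0 = Complex.I • (q + (((c * s * (dg B 2 - dg B 1).im -
      2 * s ^ 2 * (re q).re : ℝ) : ℂ)) • 1) := by
    rw [(h₂ B).2.2.1, h₁, star_add, star_smul', star_smul', star_one', hq2]
    have h' : ((c : ℂ) ^ 2 - (s : ℂ) ^ 2) * r + c * s * (dg B 2 - dg B 1).re = 0 := by
      exact_mod_cast h
    have hd := Complex.re_add_im (dg B 2 - dg B 1)
    set y := (dg B 2 - dg B 1).im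
    rw [← hd]
    have e1 : ((c : ℂ) ^ 2) = 1 - (s : ℂ) ^ 2 := by linear_combination hcs'
    have e2 : (c : ℂ) * s * (dg B 2 - dg B 1).re = -((1 - (s : ℂ) ^ 2 - (s : ℂ) ^ 2) * r) := by
      rw [← e1]; linear_combination h'
    rw [mul_add, e2, e1]
    push_cast
    module
  set q' := q + (((c * s * (dg B 2 - dg B 1).im - 2 * s ^ 2 * (re q).re : ℝ) : ℂ)) • 1
  have hq' : conj q' = q' := by
    rw [conj_add, hq, Cayley.conj_smul, conj_one, Complex.conj_ofReal]
  obtain ⟨a, hac, ha, r', hr'⟩ := exists_unit_sq hq'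
  obtain ⟨g₃, hg₃, h₃⟩ := exists_triality hac ha 0
  refine ⟨g₃ * (g₂ * g₁), mul_mem hg₃ (mul_mem hg₂ hg₁), r', ?_⟩
  change od (g₃ (g₂ B)) 0 = _
  rw [(h₃ _).2.1, hod, hr', Cayley.mul_smul, Cayley.smul_mul, Cayley.mul_smul, Cayley.smul_mul,
    star_mul_sq_mul_star ha, smul_smul]

/-- `Spin₁(10)` moves the isotropic vector `(ξ₁, ξ₂, x₀)` of its vector representation to one with
only `ξ₂` left. -/
theorem exists_dg_one_od_zero_eq_zero {A : J ℂ} (hA : cross A A = 0) :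
    ∃ g ∈ Spin10 0, dg (g A) 1 = 0 ∧ od (g A) 0 = 0 := by
  obtain ⟨g₁, hg₁, r, h₁⟩ := exists_od_zero_imag A
  set B := g₁ A with hB
  have hBB : cross B B = 0 := cross_self_eq_zero hg₁.1 hA
  -- a phase makes `ξ₁` imaginary; then so is `ξ₂`, as `ξ₁ ξ₂ = N(x₀) = -r²`
  obtain ⟨u, hu, ρ, -, hρ⟩ := exists_unit_mul (-Complex.I * dg B 1)
  obtain ⟨g₂, hg₂, h₂⟩ := exists_phase (u := ![1, u, starRingEnd ℂ u]) (k := 0)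
    (by intro i; fin_cases i <;> simp [hu, mul_comm u]) (by simp [mul_comm u, hu]) rfl
  set C := g₂ B with hC
  have hCC : cross C C = 0 := cross_self_eq_zero hg₂.1 hBB
  have hC0 : od C 0 = (Complex.I * r) • 1 := by
    rw [hC, (h₂ B).2, h₁]; simp [mul_comm u, hu]
  have hC1 : dg C 1 = Complex.I * ρ := by
    rw [hC, (h₂ B).1, ← hρ]
    simp only [Matrix.cons_val]
    linear_combination (u ^ 2 * dg B 1) * Complex.I_mul_I
  have hprod : dg C 1 * dg C 2 = -(r : ℂ) ^ 2 := by
    have h := dg_mul_dg hCC 0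
    simp only [zero_add] at h
    rw [h, hC0, normForm_smul]
    simp [normForm, star_one', Cayley.one_mul, mul_pow]
  by_cases hρ0 : ρ = 0
  · refine ⟨g₂ * g₁, mul_mem hg₂ hg₁, ?_, ?_⟩
    · change dg C 1 = 0
      rw [hC1, hρ0]; simp
    · change od C 0 = 0
      have : r = 0 := by
        rw [hC1, hρ0] at hprod
        simpa using hprod
      rw [hC0, this]; simp
  have hC2 : dg C 2 = Complex.I * (r ^ 2 / ρ : ℝ) := by
    have hρ' : (ρ : ℂ) ≠ 0 := by exact_mod_cast hρ0
    rw [hC1] at hprod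
    apply mul_left_cancel₀ (mul_ne_zero Complex.I_ne_zero hρ')
    rw [hprod]; push_cast; field_simp
    rw [Complex.I_sq, mul_neg_one]
  -- all of `ξ₁`, `ξ₂`, `x₀` are now imaginary scalars, so a real rotation can remove `x₀`
  obtain ⟨c, s, hcs, h⟩ := exists_double_angle r (r ^ 2 / ρ - ρ)
  obtain ⟨g₃, hg₃, h₃⟩ := exists_rotation hcs
  set D := g₃ C with hD
  have hDD : cross D D = 0 := cross_self_eq_zero hg₃.1 hCC
  have hD0 : od D 0 = 0 := by
    rw [hD, (h₃ C).2.2.1, hC0, hC1, hC2, star_smul', star_one']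
    have h' : ((c : ℂ) ^ 2 - (s : ℂ) ^ 2) * r + c * s * ((r ^ 2 / ρ : ℝ) - ρ) = 0 := by
      exact_mod_cast h
    rw [smul_smul, smul_smul, ← sub_smul, ← add_smul]
    convert zero_smul ℂ (1 : Cayley ℂ) using 2
    linear_combination Complex.I * h'
  have hprod' : dg D 1 * dg D 2 = 0 := by
    have h := dg_mul_dg hDD 0
    simp only [zero_add] at h
    rw [h, hD0]; simp [normForm]
  rcases mul_eq_zero.1 hprod' with h | h
  · exact ⟨g₃ * (g₂ * g₁), mul_mem hg₃ (mul_mem hg₂ hg₁), h, hD0⟩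
  -- if `ξ₂` vanishes instead of `ξ₁`, the quarter turn exchanges them
  · obtain ⟨g₄, hg₄, h₄⟩ := exists_rotation (c := 0) (s := 1) (by norm_num)
    refine ⟨g₄ * (g₃ * (g₂ * g₁)), mul_mem hg₄ (mul_mem hg₃ (mul_mem hg₂ hg₁)), ?_, ?_⟩
    · change dg (g₄ D) 1 = 0
      rw [(h₄ D).1, h]; simp
    · change od (g₄ D) 0 = 0
      rw [(h₄ D).2.2.1, hD0]; simp

/-- `Spin₁(10)` moves an element of rank one into the vector representation
`{ξ₁ = 0, x₀ = x₂ = 0}` of `Spin₂(10)`. -/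
theorem exists_reduction {A : J ℂ} (hA : cross A A = 0) :
    ∃ g ∈ Spin10 0, dg (g A) 1 = 0 ∧ od (g A) 0 = 0 ∧ od (g A) 2 = 0 := by
  obtain ⟨g₁, hg₁, h1, h0⟩ := exists_dg_one_od_zero_eq_zero hA
  set B := g₁ A with hB
  have hBB : cross B B = 0 := cross_self_eq_zero hg₁.1 hA
  by_cases hB2 : od B 2 = 0
  · exact ⟨g₁, hg₁, h1, h0, hB2⟩
  have h2 : dg B 2 = 0 := by
    have h := star_od_mul_od hBB 2
    rw [show (2 : Fin 3) + 1 = 0 from rfl, h0, zero_mul, star_zero] at h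
    exact (smul_eq_zero.1 h.symm).resolve_right hB2
  have hN : od B 2 * star (od B 2) = 0 := by
    have h := dg_mul_dg hBB 2
    rw [show (2 : Fin 3) + 2 = 1 from rfl, h1, mul_zero] at h
    rw [mul_star_self, ← h, zero_smul]
  have hxy : star (od B 2) * star (od B 1) = 0 := by
    have h := star_od_mul_od hBB 0
    rw [h0, smul_zero, star_mul] at h
    exact h
  obtain ⟨w, hw, hy⟩ := exists_real_mul_eq hB2 hN hxy
  obtain ⟨a, hac, ha, r, rfl⟩ := exists_unit_sq hw
  obtain ⟨g₂, hg₂, h₂⟩ := exists_triality hac ha 0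
  set C := g₂ B with hC
  -- `x̄₁ = r (x₂ a) a` becomes `r (x₂ a)`, while `x₂` becomes `x₂ a`
  have hC1 : star (od C 1) = (r : ℂ) • od C 2 := by
    rw [hC, (h₂ B).2.2.1, (h₂ B).2.2.2, star_mul, hy, Cayley.mul_smul, Cayley.smul_mul,
      ← mul_mul_self, mul_mul_star_cancel, ha, one_smul]
  have hC0 : od C 0 = 0 := by rw [hC, (h₂ B).2.1, h0]; simp
  have hd1 : dg C 1 = 0 := by rw [hC, (h₂ B).1, h1]
  have hd2 : dg C 2 = 0 := by rw [hC, (h₂ B).1, h2]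
  have hn : 0 < 1 + r ^ 2 := by positivity
  have hn2 : (√(1 + r ^ 2)) ^ 2 = 1 + r ^ 2 := Real.sq_sqrt hn.le
  have hn0 : √(1 + r ^ 2) ≠ 0 := (Real.sqrt_pos.2 hn).ne'
  obtain ⟨g₃, hg₃, h₃⟩ := exists_rotation (c := -r / √(1 + r ^ 2)) (s := 1 / √(1 + r ^ 2)) (by
    rw [div_pow, div_pow, hn2]; field_simp; ring)
  refine ⟨g₃ * (g₂ * g₁), mul_mem hg₃ (mul_mem hg₂ hg₁), ?_, ?_, ?_⟩
  · change dg (g₃ C) 1 = 0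
    rw [(h₃ C).1, hC0, hd1, hd2]; simp
  · change od (g₃ C) 0 = 0
    rw [(h₃ C).2.2.1, hC0, hd1, hd2]; simp
  · change od (g₃ C) 2 = 0
    rw [(h₃ C).2.2.2, hC1, smul_smul, ← add_smul]
    convert zero_smul ℂ (od C 2) using 2
    push_cast; ring

/-- `Spin₂(10)` preserves its vector representation `{ξ₁ = 0, x₀ = x₂ = 0}`, which is the set of
`B` with `B = 4 E₂ × (E₂ × B)`. -/
theorem mem_vector_of_mem {g : J ℂ ≃ₗ[ℂ] J ℂ} (hg : g ∈ Spin10 1) {B : J ℂ}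
    (h : dg B 1 = 0 ∧ od B 0 = 0 ∧ od B 2 = 0) :
    dg (g B) 1 = 0 ∧ od (g B) 0 = 0 ∧ od (g B) 2 = 0 := by
  have hk : ∀ X : J ℂ, dg (cross (idem 1) X) 1 = 0 ∧ od (cross (idem 1) X) 0 = 0 ∧
      od (cross (idem 1) X) 2 = 0 := fun X => by
    simp [dg_cross, od_cross, dg_idem]
  have hB : B = (4 : ℂ) • cross (idem 1) (cross (idem 1) B) := by
    obtain ⟨h1, h2, h3⟩ := h
    apply ext_coord <;> intro i <;> fin_cases i <;>
      simp [dg_cross, od_cross, dg_idem, h1, h2, h3]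
    · ring
    · ring
    · module
  have hτ : tau (idem 1) = idem 1 := ext_coord (fun i => by simp [dg_idem]) fun i => by
    simp [conj_zero]
  have hc : ∀ X Y, tau (cross X Y) = cross (tau X) (tau Y) := by
    intro X Y
    apply ext_coord <;> intro i
    · simp only [dg_tau, dg_cross, od_tau, map_mul, map_sub, map_add, map_inv₀, map_ofNat,
        ← re_conj, Cayley.conj_mul, conj_star]
    · simp only [od_tau, od_cross, dg_tau, Cayley.conj_smul, conj_sub, conj_add, Cayley.conj_mul,
        conj_star, map_inv₀, map_ofNat]
  have hg1 : ∀ X, cross (idem 1) (g X) = tau (g (tau (cross (idem 1) X))) := fun X => by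
    rw [← hg.1.1, hg.2]
  have hgB : g B = (4 : ℂ) • cross (idem 1) (cross (idem 1) (g B)) := by
    conv_lhs => rw [hB]
    rw [hg1 B, map_smul]
    congr 1
    have h2 := congrArg tau (hg1 (tau (cross (idem 1) B)))
    rw [tau_tau, hc, hτ, hc (idem 1) (tau _), hτ, tau_tau] at h2
    exact h2.symm
  have := hk (cross (idem 1) (g B))
  rw [hgB]
  simp [this]

/-- Every rank-one unit vector lies in `Spin₁(10) Spin₂(10) E₁`. -/
theorem exists_eq_idem_zero {A : J ℂ} (hA : cross A A = 0) (hn : herm A A = 1) :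
    ∃ g ∈ Spin10 0, ∃ h ∈ Spin10 1, h (g A) = idem 0 := by
  obtain ⟨g, hg, h⟩ := exists_reduction hA
  set B := g A with hB
  have hBB : cross B B = 0 := cross_self_eq_zero hg.1 hA
  obtain ⟨σ, hσ, hσX⟩ := exists_shift
  have hσ1 : σ (idem 1) = idem 0 := ext_coord
    (fun i => by rw [(hσX _).1, dg_idem, dg_idem]; fin_cases i <;> simp)
    fun i => by rw [(hσX _).2, od_idem, od_idem]
  obtain ⟨k, hk, hk1, hk0⟩ := exists_dg_one_od_zero_eq_zero (cross_self_eq_zero hσ hBB)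
  have hl : σ⁻¹ * (k * σ) ∈ Spin10 1 := by
    refine ⟨mul_mem (inv_mem hσ) (mul_mem hk.1 hσ), ?_⟩
    change σ.symm (k (σ (idem 1))) = idem 1
    rw [hσ1, hk.2, LinearEquiv.symm_apply_eq, hσ1]
  set l := σ⁻¹ * (k * σ) with hldef
  set C := l B with hC
  have hσC : σ C = k (σ B) := σ.apply_symm_apply _
  obtain ⟨hC1, hC0, hC2⟩ : dg C 1 = 0 ∧ od C 0 = 0 ∧ od C 2 = 0 := mem_vector_of_mem hl h
  rw [← hσC, (hσX C).1] at hk1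
  rw [← hσC, (hσX C).2] at hk0
  have hnC : herm C C = 1 := by rw [hC, hl.1.2, hB, hg.1.2, hn]
  obtain ⟨u, hu, ρ, hρ0, hρ⟩ := exists_unit_mul (dg C 0)
  obtain ⟨m, hm, hmX⟩ := exists_phase (u := ![u, 1, starRingEnd ℂ u]) (k := 1)
    (by intro i; fin_cases i <;> simp [hu, mul_comm u]) (by simp [mul_comm u, hu]) rfl
  have hk1' : dg C 2 = 0 := hk1
  have hk0' : od C 1 = 0 := hk0
  have hρ1 : ρ = 1 := by
    have hnm : herm (m C) (m C) = 1 := by rw [hm.1.2, hnC]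
    simp only [herm_eq, Fin.sum_univ_three, (hmX C).1, (hmX C).2, hC1, hk1', hC0, hC2, hk0']
      at hnm
    simp only [Matrix.cons_val, hρ] at hnm
    simp [conj_zero] at hnm
    have : ρ * ρ = 1 := by exact_mod_cast hnm
    nlinarith
  refine ⟨g, hg, m * l, mul_mem hm hl, ?_⟩
  change m C = idem 0
  apply ext_coord <;> intro i
  · rw [(hmX C).1, dg_idem]
    fin_cases i <;> simp [hC1, hk1', hρ, hρ1]
  · rw [(hmX C).2, od_idem]
    fin_cases i <;> simp [hC0, hC2, hk0']

theorem cross_idem_self (k : Fin 3) : cross (idem k) (idem k : J ℂ) = 0 := by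
  apply ext_coord <;> intro i
  · rw [dg_cross, dg_zero]
    fin_cases i <;> fin_cases k <;> simp [dg_idem]
  · rw [od_cross, od_zero]
    simp

theorem herm_idem_self (k : Fin 3) : herm (idem k) (idem k) = 1 := by
  simp [herm_eq, dg_idem, conj_zero]

end J

end ExceptionalE6

theorem theorem7 (α : ExceptionalE6.J ℂ ≃ₗ[ℂ] ExceptionalE6.J ℂ) (hα : α ∈ ExceptionalE6.E6) :
    ∃ α₁ ∈ ExceptionalE6.Spin10 0, ∃ α₂ ∈ ExceptionalE6.Spin10 1,
      ∃ α₁' ∈ ExceptionalE6.Spin10 0, α = α₁ * α₂ * α₁' := by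
  obtain ⟨g, hg, h, hh, hgh⟩ := ExceptionalE6.J.exists_eq_idem_zero
    (ExceptionalE6.J.cross_self_eq_zero hα (ExceptionalE6.J.cross_idem_self 0))
    ((hα.2 _ _).trans (ExceptionalE6.J.herm_idem_self 0))
  exact ⟨g⁻¹, inv_mem hg, h⁻¹, inv_mem hh, h * (g * α), ⟨mul_mem hh.1 (mul_mem hg.1 hα), hgh⟩,
    by group⟩
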